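/- For $1\le p\le\infty$ let $\|\cdot\|_{\ell_p}$ be the usual $\ell_p$ norm on $\mathbb{R}^m$ or $\mathbb{R}^N$, and put $1/\infty=0$. For $\rho,\alpha>0$, a linear operator $\Phi:\mathbb{R}^N\to\mathbb{R}^m$ is said to satisfy the $(p,\rho,\alpha)$-robust width property (RWP) over $B_{\ell_1}$, the closed unit ball of $\ell_1$ in $\mathbb{R}^N$, if $\|x\|_{\ell_2}\le\rho\|x\|_{\ell_1}$ for every $x\in\mathbb{R}^N$ with $\|\Phi x\|_{\ell_p}<\alpha\|x\|_{\ell_2}$. For $\rho>0$ let $T=\rho^{-1}B_{\ell_1}\cap\mathbb{S}^{N-1}$, where $\mathbb{S}^{N-1}$ is the Euclidean unit sphere of $\mathbb{R}^N$, and let $w(T)=\mathbb{E}\sup_{x\in T}\langle g,x\rangle$, where $g$ has i.i.d. $N(0,1)$ entries, be its Gaussian width (with $w(\emptyset)=0$). Theorem. There are absolute constants $c_0,c_1,c_2>0$ such that the following holds for all $m$, $N$, all $\rho>0$ and all $1\le p\le\infty$. Let $\Phi$ be an $m\times N$ standard Gaussian random matrix, i.e. with i.i.d. $N(0,1)$ entries,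 and set $\alpha=c_1m^{1/p}$. If $m\ge c_0\,w(T)^2$, then $\Phi$ satisfies the $(p,\rho,\alpha)$-RWP over $B_{\ell_1}$ with probability exceeding $1-2e^{-c_2m}$. -/

import Mathlib

open MeasureTheory ProbabilityTheory
open scoped ENNReal Pointwise

noncomputable section

/-- The `ℓ_p` norm of a vector with finitely many entries, `1 ≤ p ≤ ∞`:
`(∑ i, |u i| ^ p) ^ (1 / p)` for finite `p` and `max_i |u i|` for `p = ∞`. -/
def lpNormVec {𝕜 ι : Type*} [RCLike 𝕜] [Fintype ι] (p : ℝ≥0∞) (u : ι → 𝕜) : ℝ :=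
  ‖WithLp.toLp p u‖

/-- The `(p, ρ, α)`-robust width property of a linear operator `Φ` over the unit ball of the norm
`sharp`: every `x` with `‖Φ x‖_p < α ‖x‖₂` satisfies `‖x‖₂ ≤ ρ * sharp x`. -/
def RobustWidthProperty {𝕜 H ι : Type*} [RCLike 𝕜] [NormedAddCommGroup H]
    [InnerProductSpace 𝕜 H] [Fintype ι] (p : ℝ≥0∞) (ρ α : ℝ) (sharp : H → ℝ)
    (Φ : H →ₗ[𝕜] (ι → 𝕜)) : Prop :=
  ∀ x : H, lpNormVec p (Φ x) < α * ‖x‖ → ‖x‖ ≤ ρ * sharp x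

/-- The `ℓ_1` norm on `ℝ^N`. -/
def l1Norm {N : ℕ} (x : EuclideanSpace ℝ (Fin N)) : ℝ := ∑ i, |x i|

/-- The closed unit ball of the `ℓ_1` norm in `ℝ^N`. -/
def l1Ball (N : ℕ) : Set (EuclideanSpace ℝ (Fin N)) := {x | l1Norm x ≤ 1}

/-- The operator `ℝ^N → ℝ^m` of a real `m × N` matrix. -/
def matrixOperator {m N : ℕ} (A : Matrix (Fin m) (Fin N) ℝ) :
    EuclideanSpace ℝ (Fin N) →ₗ[ℝ] (Fin m → ℝ) :=
  A.mulVecLin ∘ₗ (WithLp.linearEquiv 2 ℝ (Fin N → ℝ)).toLinearMap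

/-- The Gaussian width `E sup_{x ∈ T} ⟨g, x⟩` of a set `T ⊆ ℝ^N`, where the entries of `g` are
i.i.d. `N(0, 1)`. The width of the empty set is `0`. -/
def gaussianWidth {N : ℕ} (T : Set (EuclideanSpace ℝ (Fin N))) : ℝ :=
  ∫ g : Fin N → ℝ, sSup ((fun x : EuclideanSpace ℝ (Fin N) => ∑ i, g i * x i) '' T)
    ∂(Measure.pi fun _ : Fin N => gaussianReal 0 1)

/-- A standard Gaussian random matrix: its entries are independent `N(0, 1)` variables. -/
structure IsStandardGaussianMatrix {Ω : Type*} [MeasurableSpace Ω] (P : Measure Ω) {m N : ℕ}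
    (Φ : Ω → Matrix (Fin m) (Fin N) ℝ) : Prop where
  hasLaw : ∀ i j, HasLaw (fun ω => Φ ω i j) (gaussianReal 0 1) P
  indep : iIndepFun (fun (ij : Fin m × Fin N) ω => Φ ω ij.1 ij.2) P

end

/-!
# Robust width of Gaussian matrices over the `ℓ₁` ball

By homogeneity, and since the `ℓ_p` norm on `ℝ^m` dominates `m ^ (1 / p - 1)` times the `ℓ_1` norm,
the robust width property follows from a lower bound `c m / 4 ≤ ∑ i, |⟪φᵢ, x⟫|`, uniform over the
compact set `T = ρ⁻¹ B ∩ S` (`robustWidthProperty_of_forall_le`), where the rows `φᵢ` are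
independent standard Gaussian vectors. Replacing `|t|` by the bounded function
`clip t = min |t| 1` only decreases the sum, and `E clip ⟪φ, x⟫` is the same number `c > 0` for all
unit vectors `x`. So it is enough to bound the empirical process
`F = sup_{x ∈ T} ∑ i, (c - clip ⟪φᵢ, x⟫)` from above by `3 c m / 4`. Two facts give this.

* `E F ≤ 2 √m w(T)` (`integral_sSup_sum_sub_clip_le`). The terms `c - clip ⟪φᵢ, x⟫` are replaced by
  `2 ⟪φᵢ, x⟫` one at a time (`integral_sSup_sub_clip_le`): this is symmetrization by an independent
  copy followed by the contraction principle for the 1-Lipschitz function `clip`, with no need for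
  Rademacher signs because the Gaussian measure is symmetric. The linear terms add up to one
  Gaussian vector of covariance `m`. The hypothesis `64 c⁻² w(T)² ≤ m` then gives `E F ≤ c m / 4`.
* `F` changes by at most `1` when one row changes, so that by the bounded differences inequality
  (`integral_exp_mul_le_of_bounded_differences`) it exceeds its mean by `c m / 2` with probability
  at most `exp (-c² m / 2)`.

The supremum over the compact set `T` is continuous in the rows, which settles measurability.
-/

/-! ### The truncated absolute value -/

/-- The absolute value truncated at height `1`. -/
def clip (t : ℝ) : ℝ := min |t| 1

lemma clip_nonneg (t : ℝ) : 0 ≤ clip t := le_min (abs_nonneg t) zero_le_one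

lemma clip_le_one (t : ℝ) : clip t ≤ 1 := min_le_right _ _

lemma clip_le_abs (t : ℝ) : clip t ≤ |t| := min_le_left _ _

lemma clip_sub_clip_le (s t : ℝ) : clip s - clip t ≤ |s - t| :=
  (le_abs_self _).trans <| (abs_inf_sub_inf_le_abs _ _ _).trans (abs_abs_sub_abs_le s t)

@[fun_prop]
lemma continuous_clip : Continuous clip := by unfold clip; fun_prop

/-- The mean of `clip` under the standard Gaussian measure on `ℝ`. -/
noncomputable def clipMean : ℝ := ∫ t, clip t ∂gaussianReal 0 1

lemma integrable_clip_comp {X : Type*} [MeasurableSpace X] {μ : Measure X} [IsProbabilityMeasure μ]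
    {f : X → ℝ} (hf : Measurable f) : Integrable (fun x => clip (f x)) μ :=
  .of_mem_Icc 0 1 (continuous_clip.measurable.comp hf).aemeasurable
    (.of_forall fun _ => ⟨clip_nonneg _, clip_le_one _⟩)

lemma clipMean_pos : 0 < clipMean := by
  rw [clipMean, integral_pos_iff_support_of_nonneg clip_nonneg (integrable_clip_comp measurable_id)]
  have : Function.support clip = {0}ᶜ := by
    ext t
    have h : clip t ≠ 0 ↔ t ≠ 0 := by
      rw [← (clip_nonneg t).lt_iff_ne', clip, lt_min_iff, abs_pos]
      simp
    simpa using h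
  have := nullSingletonClass_gaussianReal (μ := 0) (one_ne_zero (α := NNReal))
  rw [‹Function.support clip = _›, prob_compl_eq_one_sub (measurableSet_singleton 0)]
  simp

lemma clipMean_le_one : clipMean ≤ 1 := by
  calc clipMean ≤ ∫ _, 1 ∂gaussianReal 0 1 :=
        integral_mono (integrable_clip_comp measurable_id) (integrable_const _) clip_le_one
    _ = 1 := by simp

/-! ### Standard Gaussian measures -/

section StdGaussian

variable {E : Type*} [NormedAddCommGroup E] [InnerProductSpace ℝ E] [FiniteDimensional ℝ E]
  [MeasurableSpace E] [BorelSpace E]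

lemma measurePreserving_neg_stdGaussian :
    MeasurePreserving (fun x : E => -x) (stdGaussian E) (stdGaussian E) :=
  ⟨measurable_neg, stdGaussian_map (LinearIsometryEquiv.neg ℝ (E := E))⟩

lemma integral_neg_stdGaussian (f : E → ℝ) :
    ∫ x, f (-x) ∂stdGaussian E = ∫ x, f x ∂stdGaussian E :=
  measurePreserving_neg_stdGaussian.integral_comp (MeasurableEquiv.neg E).measurableEmbedding f

lemma map_inner_stdGaussian {x : E} (hx : ‖x‖ = 1) :
    (stdGaussian E).map (fun g => inner ℝ g x) = gaussianReal 0 1 := by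
  apply Measure.ext_of_charFun
  ext t
  rw [charFun_gaussianReal, charFun_apply, integral_map (by fun_prop) (by fun_prop)]
  have := charFun_stdGaussian (E := E) (t • x)
  rw [charFun_apply] at this
  simp only [inner_smul_right, norm_smul, hx] at this
  convert this using 2
  · ext g; simp
  · simp [← Complex.ofReal_pow, neg_div]

lemma integral_clip_inner_stdGaussian {x : E} (hx : ‖x‖ = 1) :
    ∫ g, clip (inner ℝ g x) ∂stdGaussian E = clipMean := by
  rw [clipMean, ← map_inner_stdGaussian hx, integral_map (by fun_prop) (by fun_prop)]

/-- Stability: `g + r g'` is distributed as `s g` when `1 + r ^ 2 = s ^ 2`. -/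
lemma map_add_smul_stdGaussian {r s : ℝ} (h : 1 + r ^ 2 = s ^ 2) :
    ((stdGaussian E).prod (stdGaussian E)).map (fun p => p.1 + r • p.2) =
      (stdGaussian E).map (fun g => s • g) := by
  have h1 : ((stdGaussian E).prod (stdGaussian E)).map (fun p => p.1 + r • p.2) =
      (stdGaussian E).conv ((stdGaussian E).map (fun g => r • g)) := by
    have h2 := Measure.map_prod_map (stdGaussian E) (stdGaussian E) measurable_id
      (measurable_const_smul r)
    rw [Measure.map_id] at h2
    rw [Measure.conv, h2, Measure.map_map (by fun_prop) (by fun_prop)]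
    rfl
  have : IsProbabilityMeasure ((stdGaussian E).map (fun g => r • g)) :=
    Measure.isProbabilityMeasure_map (by fun_prop)
  apply Measure.ext_of_charFun
  ext t
  rw [h1, charFun_conv, charFun_map_smul, charFun_map_smul, charFun_stdGaussian,
    charFun_stdGaussian, charFun_stdGaussian, ← Complex.exp_add, norm_smul, norm_smul]
  congr 1
  simp only [Complex.ofReal_mul, mul_pow, ← Complex.ofReal_pow, Real.norm_eq_abs, sq_abs, ← h]
  push_cast
  ring

lemma integral_add_smul_stdGaussian {r s : ℝ} (h : 1 + r ^ 2 = s ^ 2) {f : E → ℝ}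
    (hf : Continuous f) :
    ∫ p, f (p.1 + r • p.2) ∂(stdGaussian E).prod (stdGaussian E) =
      ∫ g, f (s • g) ∂stdGaussian E := by
  have h1 : AEMeasurable (fun p : E × E => p.1 + r • p.2)
      ((stdGaussian E).prod (stdGaussian E)) := by fun_prop
  have h2 : AEMeasurable (fun g : E => s • g) (stdGaussian E) := by fun_prop
  rw [← integral_map h1 hf.aestronglyMeasurable, ← integral_map h2 hf.aestronglyMeasurable,
    map_add_smul_stdGaussian h]

end StdGaussian

/-! ### The bounded differences inequality -/

section BoundedDifferences

variable {X : Type*} [MeasurableSpace X] {μ : Measure X} [IsProbabilityMeasure μ]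

lemma measurePreserving_cons (μ : Measure X) [SigmaFinite μ] (n : ℕ) :
    MeasurePreserving (fun p : X × (Fin n → X) => (Fin.cons p.1 p.2 : Fin (n + 1) → X))
      (μ.prod (Measure.pi fun _ => μ)) (Measure.pi fun _ => μ) := by
  have h := (measurePreserving_piFinSuccAbove (fun _ : Fin (n + 1) => μ) 0).symm
  convert h using 1
  ext p i
  simp [MeasurableEquiv.piFinSuccAbove_symm_apply, Fin.insertNthEquiv]

lemma integral_pi_succ {n : ℕ} {f : (Fin (n + 1) → X) → ℝ}
    (hf : Integrable f (Measure.pi fun _ => μ)) :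
    ∫ v, f v ∂(Measure.pi fun _ => μ) =
      ∫ w, ∫ x, f (Fin.cons x w) ∂μ ∂(Measure.pi fun _ : Fin n => μ) := by
  have h := measurePreserving_cons μ n
  rw [← h.map_eq, integral_map h.aemeasurable (h.map_eq ▸ hf.aestronglyMeasurable),
    integral_prod_symm]
  exact h.integrable_comp_of_integrable hf

/-- **Hoeffding's lemma** for a function of oscillation at most `1`. -/
lemma integral_exp_mul_le_of_forall_le_add_one {f : X → ℝ} (hf : Measurable f)
    (h : ∀ x y, f x ≤ f y + 1) (t : ℝ) :
    ∫ x, Real.exp (t * f x) ∂μ ≤ Real.exp (t * (∫ x, f x ∂μ) + t ^ 2 / 8) := by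
  have : Nonempty X := nonempty_of_isProbabilityMeasure μ
  have x₀ : X := Classical.arbitrary X
  have hbdd : BddBelow (Set.range f) :=
    ⟨f x₀ - 1, by rintro _ ⟨y, rfl⟩; linarith [h x₀ y]⟩
  have hmem : ∀ x, f x ∈ Set.Icc (⨅ y, f y) ((⨅ y, f y) + 1) := fun x =>
    ⟨ciInf_le hbdd x, by
      have : f x - 1 ≤ ⨅ y, f y := le_ciInf fun y => by linarith [h x y]
      linarith⟩
  have hm := (hasSubgaussianMGF_of_mem_Icc (μ := μ) hf.aemeasurable (.of_forall hmem)).mgf_le t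
  have e : ∀ x, Real.exp (t * f x) =
      Real.exp (t * ∫ x, f x ∂μ) * Real.exp (t * (f x - ∫ x, f x ∂μ)) := fun x => by
    rw [← Real.exp_add]; ring_nf
  simp_rw [e]
  rw [integral_const_mul, Real.exp_add]
  gcongr
  refine hm.trans_eq ?_
  congr 1
  norm_num
  ring

/-- **McDiarmid's inequality**, as a bound on the moment generating function: a function of `n`
independent variables that moves by at most `1` when one of them changes is sub-Gaussian with
variance proxy `n / 4`. Hoeffding's lemma is applied to one variable at a time, the mean over that
variable being again a function with bounded differences. -/
theorem integral_exp_mul_le_of_bounded_differences (t : ℝ) {n : ℕ} {F : (Fin n → X) → ℝ}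
    (hF : Measurable F) {B : ℝ} (hB : ∀ v, |F v| ≤ B)
    (h : ∀ i v w, (∀ j ≠ i, v j = w j) → F v ≤ F w + 1) :
    ∫ v, Real.exp (t * F v) ∂(Measure.pi fun _ => μ) ≤
      Real.exp (t * (∫ v, F v ∂(Measure.pi fun _ => μ)) + n * (t ^ 2 / 8)) := by
  induction n with
  | zero => simp [integral_unique]
  | succ n ih =>
    have hFc : Measurable fun p : X × (Fin n → X) => F (Fin.cons p.1 p.2) :=
      hF.comp (measurePreserving_cons μ n).measurable
    have hFi {Y : Type _} [MeasurableSpace Y] (ν : Measure Y) [IsProbabilityMeasure ν]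
        {f : Y → ℝ} (hf : Measurable f) (hfB : ∀ y, |f y| ≤ B) :
        Integrable f ν :=
      .of_mem_Icc (-B) B hf.aemeasurable (.of_forall fun y => abs_le.1 (hfB y))
    have hFe {Y : Type _} [MeasurableSpace Y] (ν : Measure Y) [IsProbabilityMeasure ν]
        {f : Y → ℝ} (hf : Measurable f) (hfB : ∀ y, |f y| ≤ B) :
        Integrable (fun y => Real.exp (t * f y)) ν :=
      integrable_exp_mul_of_mem_Icc hf.aemeasurable (.of_forall fun y => abs_le.1 (hfB y))
    set H : (Fin n → X) → ℝ := fun w => ∫ x, F (Fin.cons x w) ∂μ with hH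
    have hHm : Measurable H := by
      have : StronglyMeasurable fun p : (Fin n → X) × X => F (Fin.cons p.2 p.1) :=
        (hFc.comp measurable_swap).stronglyMeasurable
      exact this.integral_prod_right.measurable
    have hcons (w : Fin n → X) : Measurable fun x => F (Fin.cons x w) :=
      hFc.comp measurable_prodMk_right
    have hHB : ∀ w, |H w| ≤ B := fun w => by
      have := norm_integral_le_of_norm_le_const (μ := μ) (f := fun x => F (Fin.cons x w))
        (.of_forall fun x => hB _)
      simpa using this
    have hHd : ∀ i v w, (∀ j ≠ i, v j = w j) → H v ≤ H w + 1 := fun i v w hvw => by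
      have : ∫ x, F (Fin.cons x v) ∂μ ≤ ∫ x, (F (Fin.cons x w) + 1) ∂μ := by
        refine integral_mono (hFi _ (hcons v) fun _ => hB _)
          ((hFi _ (hcons w) fun _ => hB _).add (integrable_const _)) fun x => ?_
        refine h i.succ _ _ fun j hj => ?_
        induction j using Fin.cases with
        | zero => rfl
        | succ j => simpa using hvw j (by simpa using hj)
      rwa [integral_add (hFi _ (hcons w) fun _ => hB _) (integrable_const _), integral_const,
        probReal_univ, one_smul] at this
    rw [integral_pi_succ (hFe _ hF hB), integral_pi_succ (hFi _ hF hB)]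
    calc ∫ w, ∫ x, Real.exp (t * F (Fin.cons x w)) ∂μ ∂(Measure.pi fun _ => μ)
        ≤ ∫ w, Real.exp (t * H w) * Real.exp (t ^ 2 / 8) ∂(Measure.pi fun _ => μ) := by
          refine integral_mono_of_nonneg (.of_forall fun w => integral_nonneg fun x => by positivity)
            ((hFe _ hHm hHB).mul_const _) (.of_forall fun w => ?_)
          beta_reduce
          rw [← Real.exp_add]
          refine integral_exp_mul_le_of_forall_le_add_one (hcons w) (fun x y => h 0 _ _ ?_) t
          intro j hj
          induction j using Fin.cases with
          | zero => exact absurd rfl hj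
          | succ j => rfl
      _ ≤ Real.exp (t * (∫ w, H w ∂(Measure.pi fun _ => μ)) + n * (t ^ 2 / 8)) *
            Real.exp (t ^ 2 / 8) := by
          rw [integral_mul_const]
          gcongr
          exact ih hHm hHB hHd
      _ = _ := by
          rw [← Real.exp_add]
          congr 1
          push_cast
          ring

end BoundedDifferences

/-! ### Suprema over a compact set -/

section Supremum

lemma sSup_image_le_of_forall_le {E : Type*} {K : Set E} (hne : K.Nonempty) {f : E → ℝ} {B : ℝ}
    (h : ∀ x ∈ K, f x ≤ B) : sSup (f '' K) ≤ B :=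
  csSup_le (hne.image f) (Set.forall_mem_image.2 h)

variable {E : Type*} [TopologicalSpace E] {K : Set E}

lemma IsCompact.le_sSup_image (hK : IsCompact K) {f : E → ℝ} (hf : Continuous f) {x : E}
    (hx : x ∈ K) : f x ≤ sSup (f '' K) :=
  le_csSup (hK.bddAbove_image hf.continuousOn) (Set.mem_image_of_mem f hx)

lemma IsCompact.abs_sSup_image_le (hK : IsCompact K) (hne : K.Nonempty) {f : E → ℝ}
    (hf : Continuous f) {B : ℝ} (h : ∀ x ∈ K, |f x| ≤ B) : |sSup (f '' K)| ≤ B := by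
  obtain ⟨x, hx⟩ := hne
  exact abs_le.2 ⟨(abs_le.1 (h x hx)).1.trans (hK.le_sSup_image hf hx),
    sSup_image_le_of_forall_le ⟨x, hx⟩ fun y hy => (abs_le.1 (h y hy)).2⟩

lemma IsCompact.integrable_sSup_image (hK : IsCompact K) (hne : K.Nonempty)
    {Y : Type*} [TopologicalSpace Y] [MeasurableSpace Y] [OpensMeasurableSpace Y] {ν : Measure Y}
    {f : Y → E → ℝ} (hf : Continuous (Function.uncurry f)) {G : Y → ℝ} (hG : Integrable G ν)
    (h : ∀ y, ∀ x ∈ K, |f y x| ≤ G y) : Integrable (fun y => sSup (f y '' K)) ν :=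
  hG.mono' (hK.continuous_sSup hf).aestronglyMeasurable
    (.of_forall fun y => hK.abs_sSup_image_le hne (hf.comp (.prodMk_right y)) (h y))

end Supremum

/-! ### Comparison of the empirical process with the Gaussian width -/

section Comparison

lemma abs_clipMean_sub_clip_le (t : ℝ) : |clipMean - clip t| ≤ 1 :=
  abs_le.2 ⟨by linarith [clipMean_pos, clip_le_one t], by linarith [clipMean_le_one, clip_nonneg t]⟩

variable {E : Type*} [NormedAddCommGroup E] [InnerProductSpace ℝ E]

local notation "⟪" x ", " y "⟫" => inner ℝ x y

lemma abs_inner_le_norm_of_mem_sphere {x : E} (hx : x ∈ Metric.sphere (0 : E) 1) (g : E) :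
    |⟪g, x⟫| ≤ ‖g‖ := by
  simpa [mem_sphere_zero_iff_norm.1 hx] using abs_real_inner_le_norm g x

lemma abs_sum_clipMean_sub_clip_le {m : ℕ} (v : Fin m → E) (x : E) :
    |∑ i, (clipMean - clip ⟪v i, x⟫)| ≤ m := by
  refine (Finset.abs_sum_le_sum_abs _ _).trans ?_
  simpa using Finset.sum_le_sum fun i (_ : i ∈ Finset.univ) =>
    abs_clipMean_sub_clip_le ⟪v i, x⟫

variable [FiniteDimensional ℝ E] [MeasurableSpace E] [BorelSpace E] {K : Set E}

lemma integrable_norm_stdGaussian : Integrable (fun g : E => ‖g‖) (stdGaussian E) :=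
  IsGaussian.integrable_id.norm

/-- Symmetrization and contraction for a single Gaussian vector: inside the expected supremum, the
centred term `clipMean - clip ⟪φ, x⟫` may be replaced by the linear term `2 * ⟪φ, x⟫`, in the
presence of any continuous function `a`. -/
lemma integral_sSup_sub_clip_le (hK : IsCompact K) (hne : K.Nonempty)
    (hs : K ⊆ Metric.sphere 0 1) {a : E → ℝ} (ha : Continuous a) :
    ∫ φ, sSup ((fun x => a x + (clipMean - clip ⟪φ, x⟫)) '' K) ∂stdGaussian E ≤
      ∫ φ, sSup ((fun x => a x + 2 * ⟪φ, x⟫) '' K) ∂stdGaussian E := by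
  obtain ⟨A, hA⟩ := hK.exists_bound_of_continuousOn ha.continuousOn
  simp only [Real.norm_eq_abs] at hA
  set γ := stdGaussian E
  let L : E → ℝ := fun φ => sSup ((fun x => a x + 2 * ⟪φ, x⟫) '' K)
  let D : E × E → ℝ := fun p => sSup ((fun x => a x + (clip ⟪p.2, x⟫ - clip ⟪p.1, x⟫)) '' K)
  have hDb : ∀ p : E × E, ∀ x ∈ K, |a x + (clip ⟪p.2, x⟫ - clip ⟪p.1, x⟫)| ≤ A + 1 :=
    fun p x hx => (abs_add_le _ _).trans <| add_le_add (hA x hx) <| abs_le.2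
      ⟨by linarith [clip_nonneg ⟪p.2, x⟫, clip_le_one ⟪p.1, x⟫],
        by linarith [clip_nonneg ⟪p.1, x⟫, clip_le_one ⟪p.2, x⟫]⟩
  have hDi : Integrable D (γ.prod γ) :=
    hK.integrable_sSup_image hne (by fun_prop) (integrable_const (A + 1)) hDb
  have hL : Integrable L γ := by
    refine hK.integrable_sSup_image hne (by fun_prop)
      ((integrable_const A).add (integrable_norm_stdGaussian.const_mul 2)) fun φ x hx => ?_
    refine (abs_add_le _ _).trans (add_le_add (hA x hx) ?_)
    rw [abs_mul, abs_two]
    exact mul_le_mul_of_nonneg_left (abs_inner_le_norm_of_mem_sphere (hs hx) φ) zero_le_two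
  have hLn : Integrable (fun φ => L (-φ)) γ :=
    measurePreserving_neg_stdGaussian.integrable_comp_of_integrable hL
  have hDi' (φ : E) : Integrable (fun φ' => D (φ, φ')) γ :=
    hK.integrable_sSup_image hne (by fun_prop) (integrable_const (A + 1)) fun φ' => hDb (φ, φ')
  have hD_le (φ φ' : E) {x : E} (hx : x ∈ K) :
      a x + (clip ⟪φ', x⟫ - clip ⟪φ, x⟫) ≤ D (φ, φ') :=
    hK.le_sSup_image (f := fun x => a x + (clip ⟪φ', x⟫ - clip ⟪φ, x⟫)) (by fun_prop) hx
  -- The mean of `clip` is an average over an independent copy `φ'` of `φ`; it is moved out of the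
  -- supremum.
  have le_integral_copy (φ : E) : sSup ((fun x => a x + (clipMean - clip ⟪φ, x⟫)) '' K) ≤
      ∫ φ', D (φ, φ') ∂γ := by
    refine sSup_image_le_of_forall_le hne fun x hx => ?_
    have hi : Integrable (fun φ' : E => clip ⟪φ', x⟫) γ := integrable_clip_comp (by fun_prop)
    have e : ∫ φ', (a x + (clip ⟪φ', x⟫ - clip ⟪φ, x⟫)) ∂γ =
        a x + (clipMean - clip ⟪φ, x⟫) := by
      rw [integral_add (integrable_const _) (by fun_prop), integral_sub hi (integrable_const _),
        integral_clip_inner_stdGaussian (mem_sphere_zero_iff_norm.1 (hs hx))]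
      simp
    rw [← e]
    exact integral_mono ((integrable_const _).add (hi.sub (integrable_const _))) (hDi' φ)
      fun φ' => hD_le φ φ' hx
  -- Exchanging `φ` and `φ'` symmetrizes `D`. For a pair `x`, `y` of points of `K`, the Lipschitz
  -- bound for `clip` leaves `|⟪φ, x - y⟫| + |⟪φ', x - y⟫|`; averaging the bounds for `φ` and `φ'`
  -- separates the two summands, at the price of the factor `2` in `L`.
  have add_swap_le (p : E × E) : D p + D p.swap ≤
      2⁻¹ * ((L p.1 + L (-p.1)) + (L p.2 + L (-p.2))) := by
    obtain ⟨φ, φ'⟩ := p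
    have hLx (ψ : E) {x : E} (hx : x ∈ K) : a x + 2 * ⟪ψ, x⟫ ≤ L ψ :=
      hK.le_sSup_image (f := fun x => a x + 2 * ⟪ψ, x⟫) (by fun_prop) hx
    have hpair (ψ : E) {x y : E} (hx : x ∈ K) (hy : y ∈ K) :
        a x + a y + 2 * |⟪ψ, x⟫ - ⟪ψ, y⟫| ≤ L ψ + L (-ψ) := by
      have h1 := hLx ψ hx
      have h2 := hLx ψ hy
      have h3 := hLx (-ψ) hx
      have h4 := hLx (-ψ) hy
      rw [inner_neg_left] at h3 h4
      rcases abs_cases (⟪ψ, x⟫ - ⟪ψ, y⟫) with h | h <;> rw [h.1] <;> linarith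
    have key {x y : E} (hx : x ∈ K) (hy : y ∈ K) :
        (a x + (clip ⟪φ', x⟫ - clip ⟪φ, x⟫)) + (a y + (clip ⟪φ, y⟫ - clip ⟪φ', y⟫)) ≤
          2⁻¹ * ((L φ + L (-φ)) + (L φ' + L (-φ'))) := by
      have h1 := hpair φ hx hy
      have h2 := hpair φ' hx hy
      have h3 := clip_sub_clip_le ⟪φ', x⟫ ⟪φ', y⟫
      have h4 := clip_sub_clip_le ⟪φ, y⟫ ⟪φ, x⟫
      rw [abs_sub_comm] at h4
      linarith
    have : D (φ, φ') ≤ 2⁻¹ * ((L φ + L (-φ)) + (L φ' + L (-φ'))) - D (φ', φ) := by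
      refine sSup_image_le_of_forall_le hne fun x hx => ?_
      rw [le_sub_comm]
      refine sSup_image_le_of_forall_le hne fun y hy => ?_
      have := key hx hy
      dsimp only at this ⊢
      linarith
    have e : (φ, φ').swap = (φ', φ) := rfl
    rw [e]
    dsimp only
    linarith
  have h2D : ∫ p, D p ∂γ.prod γ + ∫ p, D p ∂γ.prod γ ≤ 2 * ∫ φ, L φ ∂γ := by
    have hDs : Integrable (fun p : E × E => D p.swap) (γ.prod γ) := hDi.swap
    have i1 : Integrable (fun p : E × E => L p.1 + L (-p.1)) (γ.prod γ) :=
      (hL.add hLn).comp_fst γ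
    have i2 : Integrable (fun p : E × E => L p.2 + L (-p.2)) (γ.prod γ) :=
      (hL.add hLn).comp_snd γ
    calc ∫ p, D p ∂γ.prod γ + ∫ p, D p ∂γ.prod γ
        = ∫ p, (D p + D p.swap) ∂γ.prod γ := by
          rw [integral_add hDi hDs, integral_prod_swap]
      _ ≤ ∫ p, 2⁻¹ * ((L p.1 + L (-p.1)) + (L p.2 + L (-p.2))) ∂γ.prod γ :=
          integral_mono (hDi.add hDs) ((i1.add i2).const_mul _) add_swap_le
      _ = 2 * ∫ φ, L φ ∂γ := by
          rw [integral_const_mul, integral_add i1 i2,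
            integral_fun_fst (fun φ => L φ + L (-φ)), integral_fun_snd (fun φ => L φ + L (-φ)),
            integral_add hL hLn, integral_neg_stdGaussian L]
          simp
          ring
  have h1 : ∫ φ, sSup ((fun x => a x + (clipMean - clip ⟪φ, x⟫)) '' K) ∂γ ≤
      ∫ p, D p ∂γ.prod γ := by
    rw [integral_prod _ hDi]
    refine integral_mono (hK.integrable_sSup_image hne (by fun_prop) (integrable_const (A + 1))
      fun φ x hx => ?_) hDi.integral_prod_left le_integral_copy
    exact (abs_add_le _ _).trans (add_le_add (hA x hx) (abs_clipMean_sub_clip_le _))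
  linarith

/-- For `a = 0` the right-hand side is `2 * √m` times the Gaussian width of `K`; a general `a` is
what makes the induction on the number of rows work. -/
theorem integral_sSup_sum_sub_clip_le (hK : IsCompact K) (hne : K.Nonempty)
    (hs : K ⊆ Metric.sphere 0 1) (m : ℕ) {a : E → ℝ} (ha : Continuous a) :
    ∫ v, sSup ((fun x => a x + ∑ i, (clipMean - clip ⟪v i, x⟫)) '' K)
        ∂(Measure.pi fun _ : Fin m => stdGaussian E) ≤
      ∫ g, sSup ((fun x => a x + 2 * (√m * ⟪g, x⟫)) '' K) ∂stdGaussian E := by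
  induction m generalizing a with
  | zero => simp
  | succ k ih =>
    obtain ⟨A, hA⟩ := hK.exists_bound_of_continuousOn ha.continuousOn
    simp only [Real.norm_eq_abs] at hA
    set γ := stdGaussian E
    set π := Measure.pi fun _ : Fin k => γ
    have hi : Integrable
        (fun v : Fin (k + 1) → E =>
          sSup ((fun x => a x + ∑ i, (clipMean - clip ⟪v i, x⟫)) '' K))
        (Measure.pi fun _ => γ) :=
      hK.integrable_sSup_image hne (by fun_prop) (integrable_const (A + (k + 1 : ℕ))) fun v x hx =>
        (abs_add_le _ _).trans (add_le_add (hA x hx) (abs_sum_clipMean_sub_clip_le v x))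
    have h2 (φ : E) {x : E} (hx : x ∈ K) : |2 * ⟪φ, x⟫| ≤ 2 * ‖φ‖ := by
      rw [abs_mul, abs_two]
      exact mul_le_mul_of_nonneg_left (abs_inner_le_norm_of_mem_sphere (hs hx) φ) zero_le_two
    have hM : Integrable (fun p : (Fin k → E) × E =>
        sSup ((fun x => (a x + ∑ i, (clipMean - clip ⟪p.1 i, x⟫)) + 2 * ⟪p.2, x⟫) '' K))
        (π.prod γ) := by
      refine hK.integrable_sSup_image hne (by fun_prop) ((integrable_const (A + k)).add
        ((integrable_norm_stdGaussian.const_mul 2).comp_snd π)) fun p x hx => ?_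
      exact (abs_add_le _ _).trans (add_le_add ((abs_add_le _ _).trans
        (add_le_add (hA x hx) (abs_sum_clipMean_sub_clip_le p.1 x))) (h2 p.2 hx))
    have hG : Integrable (fun p : E × E =>
        sSup ((fun x => (a x + 2 * ⟪p.1, x⟫) + 2 * (√k * ⟪p.2, x⟫)) '' K)) (γ.prod γ) := by
      refine hK.integrable_sSup_image hne (by fun_prop) (((integrable_const A).add
        ((integrable_norm_stdGaussian.const_mul 2).comp_fst γ)).add
        ((integrable_norm_stdGaussian.const_mul (√k * 2)).comp_snd γ)) fun p x hx => ?_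
      refine (abs_add_le _ _).trans (add_le_add ((abs_add_le _ _).trans
        (add_le_add (hA x hx) (h2 p.1 hx))) ?_)
      rw [mul_left_comm, abs_mul, abs_of_nonneg (Real.sqrt_nonneg _)]
      simp only [mul_assoc]
      exact mul_le_mul_of_nonneg_left (h2 p.2 hx) (Real.sqrt_nonneg _)
    have hrot : 1 + (√(k : ℝ)) ^ 2 = (√((k + 1 : ℕ) : ℝ)) ^ 2 := by
      rw [Real.sq_sqrt (by positivity), Real.sq_sqrt (by positivity)]
      push_cast
      ring
    calc ∫ v, sSup ((fun x => a x + ∑ i, (clipMean - clip ⟪v i, x⟫)) '' K)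
          ∂(Measure.pi fun _ : Fin (k + 1) => γ)
        = ∫ w, ∫ φ, sSup ((fun x => (a x + ∑ i, (clipMean - clip ⟪w i, x⟫)) +
            (clipMean - clip ⟪φ, x⟫)) '' K) ∂γ ∂π := by
          rw [integral_pi_succ hi]
          simp only [Fin.sum_univ_succ, Fin.cons_zero, Fin.cons_succ, add_comm,
            add_left_comm]
          rfl
      _ ≤ ∫ w, ∫ φ, sSup ((fun x => (a x + ∑ i, (clipMean - clip ⟪w i, x⟫)) +
            2 * ⟪φ, x⟫) '' K) ∂γ ∂π := by
          refine integral_mono (Integrable.integral_prod_left (f := fun p : (Fin k → E) × E =>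
            sSup ((fun x => (a x + ∑ i, (clipMean - clip ⟪p.1 i, x⟫)) +
            (clipMean - clip ⟪p.2, x⟫)) '' K)) ?_) hM.integral_prod_left fun w =>
              integral_sSup_sub_clip_le hK hne hs (by fun_prop)
          exact hK.integrable_sSup_image hne (by fun_prop) (integrable_const (A + k + 1))
            fun p x hx => (abs_add_le _ _).trans (add_le_add ((abs_add_le _ _).trans
              (add_le_add (hA x hx) (abs_sum_clipMean_sub_clip_le p.1 x)))
              (abs_clipMean_sub_clip_le _))
      _ = ∫ φ, ∫ w, sSup ((fun x => (a x + 2 * ⟪φ, x⟫) +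
            ∑ i, (clipMean - clip ⟪w i, x⟫)) '' K) ∂π ∂γ := by
          rw [integral_integral_swap hM]
          simp only [add_right_comm]
      _ ≤ ∫ φ, ∫ g, sSup ((fun x => (a x + 2 * ⟪φ, x⟫) + 2 * (√k * ⟪g, x⟫)) '' K) ∂γ ∂γ := by
          refine integral_mono ?_ hG.integral_prod_left fun φ => ih (by fun_prop)
          simpa only [add_right_comm] using hM.integral_prod_right
      _ = ∫ p : E × E, sSup ((fun x => a x + 2 * ⟪p.1 + √k • p.2, x⟫) '' K) ∂γ.prod γ := by
          rw [← integral_prod _ hG]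
          simp only [inner_add_left, real_inner_smul_left, mul_add, add_assoc]
      _ = ∫ g, sSup ((fun x => a x + 2 * (√(k + 1 : ℕ) * ⟪g, x⟫)) '' K) ∂γ := by
          rw [integral_add_smul_stdGaussian hrot
            (f := fun g => sSup ((fun x => a x + 2 * ⟪g, x⟫) '' K))
            (hK.continuous_sSup (by fun_prop))]
          simp only [real_inner_smul_left, γ]

/-- If `m` dominates the squared Gaussian width of `K`, then with overwhelming probability the
truncated `ℓ_1` norm of the image of every `x ∈ K` under `m` Gaussian rows is at least a fixed
fraction of `m`. -/
theorem measureReal_exists_sum_clip_lt_le (hK : IsCompact K) (hne : K.Nonempty)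
    (hs : K ⊆ Metric.sphere 0 1) {m : ℕ}
    (hm : 64 / clipMean ^ 2 * (∫ g, sSup ((fun x => ⟪g, x⟫) '' K) ∂stdGaussian E) ^ 2 ≤ m) :
    (Measure.pi fun _ : Fin m => stdGaussian E).real
        {v | ∃ x ∈ K, ∑ i, clip ⟪v i, x⟫ < clipMean / 4 * m} ≤
      Real.exp (-(clipMean ^ 2 / 2) * m) := by
  have hc := clipMean_pos
  set c := clipMean with hcdef
  set γ := stdGaussian E
  set π := Measure.pi fun _ : Fin m => γ
  set w := ∫ g, sSup ((fun x => ⟪g, x⟫) '' K) ∂γ with hw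
  let F : (Fin m → E) → ℝ := fun v => sSup ((fun x => ∑ i, (c - clip ⟪v i, x⟫)) '' K)
  have hFc : Continuous F := hK.continuous_sSup (by fun_prop)
  have hFB : ∀ v, |F v| ≤ m := fun v =>
    hK.abs_sSup_image_le hne (by fun_prop) fun x _ => abs_sum_clipMean_sub_clip_le v x
  have hle (v : Fin m → E) {x : E} (hx : x ∈ K) : ∑ i, (c - clip ⟪v i, x⟫) ≤ F v :=
    hK.le_sSup_image (f := fun x => ∑ i, (c - clip ⟪v i, x⟫)) (by fun_prop) hx
  have hFd : ∀ i v v', (∀ j ≠ i, v j = v' j) → F v ≤ F v' + 1 := by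
    intro i v v' h
    refine sSup_image_le_of_forall_le hne fun x hx => ?_
    have h1 := hle v' hx
    rw [← Finset.add_sum_erase _ _ (Finset.mem_univ i)] at h1 ⊢
    have h2 : ∑ j ∈ Finset.univ.erase i, (c - clip ⟪v j, x⟫) =
        ∑ j ∈ Finset.univ.erase i, (c - clip ⟪v' j, x⟫) :=
      Finset.sum_congr rfl fun j hj => by rw [h j (Finset.ne_of_mem_erase hj)]
    linarith [clip_nonneg ⟪v i, x⟫, clip_le_one ⟪v' i, x⟫]
  have hmean : ∫ v, F v ∂π ≤ c / 4 * m := by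
    have h1 := integral_sSup_sum_sub_clip_le hK hne hs m (a := fun _ => 0) continuous_const
    simp only [zero_add] at h1
    have hwi : Integrable (fun g : E => sSup ((fun x => ⟪g, x⟫) '' K)) γ :=
      hK.integrable_sSup_image hne (by fun_prop) integrable_norm_stdGaussian
        fun g x hx => abs_inner_le_norm_of_mem_sphere (hs hx) g
    have h2 : ∫ g, sSup ((fun x => 2 * (√m * ⟪g, x⟫)) '' K) ∂γ ≤ 2 * (√m * w) := by
      rw [hw, ← integral_const_mul, ← integral_const_mul]
      refine integral_mono (hK.integrable_sSup_image hne (by fun_prop)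
        ((integrable_norm_stdGaussian.const_mul √m).const_mul 2) fun g x hx => ?_)
        ((hwi.const_mul _).const_mul _) fun g => ?_
      · rw [abs_mul, abs_mul, abs_two, abs_of_nonneg (Real.sqrt_nonneg _)]
        gcongr
        exact abs_inner_le_norm_of_mem_sphere (hs hx) g
      · refine sSup_image_le_of_forall_le hne fun x hx => ?_
        gcongr
        exact hK.le_sSup_image (f := fun x => ⟪g, x⟫) (by fun_prop) hx
    have h3 : w ≤ c / 8 * √m := by
      refine le_of_sq_le_sq ?_ (by positivity)
      rw [mul_pow, Real.sq_sqrt (Nat.cast_nonneg m)]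
      rw [div_mul_eq_mul_div, div_le_iff₀ (by positivity)] at hm
      linarith
    calc ∫ v, F v ∂π ≤ 2 * (√m * w) := h1.trans h2
      _ ≤ 2 * (√m * (c / 8 * √m)) := by gcongr
      _ = c / 4 * (√m * √m) := by ring
      _ = c / 4 * m := by rw [Real.mul_self_sqrt (Nat.cast_nonneg m)]
  have hexp := integral_exp_mul_le_of_bounded_differences (μ := γ) (2 * c) hFc.measurable hFB hFd
  have hsub : {v : Fin m → E | ∃ x ∈ K, ∑ i, clip ⟪v i, x⟫ < c / 4 * m} ⊆
      {v | 3 / 4 * c * m ≤ F v} := by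
    rintro v ⟨x, hx, h⟩
    have := hle v hx
    rw [Finset.sum_sub_distrib] at this
    simp only [Finset.sum_const, Finset.card_univ, Fintype.card_fin, nsmul_eq_mul] at this
    rw [Set.mem_ofPred_eq]
    linarith
  -- Chernoff's bound at `2 * c`, the optimal exponent for a deviation `c * m / 2` from the mean.
  calc π.real {v | ∃ x ∈ K, ∑ i, clip ⟪v i, x⟫ < c / 4 * m}
      ≤ π.real {v | 3 / 4 * c * m ≤ F v} := measureReal_mono hsub
    _ ≤ Real.exp (-(2 * c) * (3 / 4 * c * m)) * mgf F π (2 * c) :=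
        measure_ge_le_exp_mul_mgf _ (by positivity) (integrable_exp_mul_of_mem_Icc
          hFc.measurable.aemeasurable (.of_forall fun v => abs_le.1 (hFB v)))
    _ ≤ Real.exp (-(2 * c) * (3 / 4 * c * m)) *
          Real.exp (2 * c * (c / 4 * m) + m * ((2 * c) ^ 2 / 8)) := by
        gcongr
        refine hexp.trans ?_
        gcongr
    _ = Real.exp (-(c ^ 2 / 2) * m) := by
        rw [← Real.exp_add]
        ring_nf

end Comparison

/-! ### Robust width of a Gaussian matrix -/

/-- `‖u‖_1 ≤ m ^ (1 - 1 / p) * ‖u‖_p`, written without negative powers of `m`. -/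
lemma rpow_mul_sum_abs_le_mul_lpNormVec {m : ℕ} {p : ℝ≥0∞} (hp : 1 ≤ p) (u : Fin m → ℝ) :
    (m : ℝ) ^ (p⁻¹).toReal * ∑ i, |u i| ≤ m * lpNormVec p u := by
  rcases m.eq_zero_or_pos with rfl | hm
  · simp
  have hm' : (0 : ℝ) < m := Nat.cast_pos.2 hm
  induction p using ENNReal.recTopCoe with
  | top =>
    have : Fact ((1 : ℝ≥0∞) ≤ ∞) := ⟨le_top⟩
    have : ∀ i ∈ Finset.univ, |u i| ≤ lpNormVec ∞ u := fun i _ =>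
      PiLp.norm_apply_le (WithLp.toLp ∞ u) i
    simpa using Finset.sum_le_card_nsmul _ _ _ this
  | coe p =>
    have hp' : (1 : ℝ) ≤ p := by exact_mod_cast hp
    have hp0 : (0 : ℝ) < p := by linarith
    have h1 := Real.rpow_sum_le_const_mul_sum_rpow Finset.univ u hp'
    have h2 : lpNormVec p u = (∑ i, |u i| ^ (p : ℝ)) ^ (1 / (p : ℝ)) := by
      rw [lpNormVec, PiLp.norm_eq_sum (by simpa using hp0)]
      simp
    have h3 : ∑ i, |u i| ≤ ((m : ℝ) ^ ((p : ℝ) - 1)) ^ (1 / (p : ℝ)) * lpNormVec p u := by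
      rw [h2, ← Real.mul_rpow (by positivity) (by positivity), one_div,
        Real.le_rpow_inv_iff_of_pos (by positivity) (by positivity) hp0]
      simpa using h1
    have h4 : ((p : ℝ≥0∞)⁻¹).toReal = 1 / (p : ℝ) := by simp
    rw [h4]
    calc (m : ℝ) ^ (1 / (p : ℝ)) * ∑ i, |u i|
        ≤ (m : ℝ) ^ (1 / (p : ℝ)) *
            (((m : ℝ) ^ ((p : ℝ) - 1)) ^ (1 / (p : ℝ)) * lpNormVec p u) := by gcongr
      _ = m * lpNormVec p u := by
        rw [← Real.rpow_mul hm'.le, ← mul_assoc, ← Real.rpow_add hm']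
        have : 1 / (p : ℝ) + ((p : ℝ) - 1) * (1 / p) = 1 := by field_simp; ring
        rw [this, Real.rpow_one]

lemma gaussianWidth_eq_integral_stdGaussian {N : ℕ} {T : Set (EuclideanSpace ℝ (Fin N))}
    (hT : IsCompact T) :
    gaussianWidth T =
      ∫ g, sSup ((fun x => inner ℝ g x) '' T) ∂stdGaussian (EuclideanSpace ℝ (Fin N)) := by
  rw [← map_pi_eq_stdGaussian, integral_map (by fun_prop)
    (hT.continuous_sSup (f := fun g x => inner ℝ g x) (by fun_prop)).aestronglyMeasurable,
    gaussianWidth]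
  simp only [PiLp.inner_apply, RCLike.inner_apply, conj_trivial, mul_comm]

lemma isCompact_smul_l1Ball_inter_sphere (N : ℕ) (ρ : ℝ) :
    IsCompact (ρ⁻¹ • l1Ball N ∩ Metric.sphere 0 1) := by
  have hc : IsClosed (l1Ball N) := by
    refine isClosed_le ?_ continuous_const
    unfold l1Norm
    fun_prop
  exact (isCompact_sphere _ _).inter_left (hc.smul₀ ρ⁻¹)

lemma mem_smul_l1Ball_iff {N : ℕ} {ρ : ℝ} (hρ : 0 < ρ) {x : EuclideanSpace ℝ (Fin N)} :
    x ∈ ρ⁻¹ • l1Ball N ↔ ρ * l1Norm x ≤ 1 := by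
  rw [Set.mem_inv_smul_set_iff₀ hρ.ne']
  change l1Norm (ρ • x) ≤ 1 ↔ _
  simp [l1Norm, abs_mul, abs_of_pos hρ, Finset.mul_sum]

lemma l1Norm_smul {N : ℕ} (c : ℝ) (x : EuclideanSpace ℝ (Fin N)) :
    l1Norm (c • x) = |c| * l1Norm x := by
  simp [l1Norm, abs_mul, Finset.mul_sum]

lemma lpNormVec_smul {m : ℕ} {p : ℝ≥0∞} (hp : 1 ≤ p) (c : ℝ) (u : Fin m → ℝ) :
    lpNormVec p (c • u) = |c| * lpNormVec p u := by
  have : Fact (1 ≤ p) := ⟨hp⟩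
  simp [lpNormVec, norm_smul]

lemma matrixOperator_apply {m N : ℕ} (A : Matrix (Fin m) (Fin N) ℝ)
    (x : EuclideanSpace ℝ (Fin N)) (i : Fin m) :
    matrixOperator A x i = inner ℝ (WithLp.toLp 2 (A i)) x := by
  simp [matrixOperator, Matrix.mulVec, dotProduct, PiLp.inner_apply, mul_comm]

/-- By homogeneity it suffices to bound `‖A x‖_1` from below on the unit vectors of `ρ⁻¹ B_{ℓ_1}`. -/
lemma robustWidthProperty_of_forall_le {m N : ℕ} (hm : 0 < m) {ρ c : ℝ} (hρ : 0 < ρ) {p : ℝ≥0∞}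
    (hp : 1 ≤ p) {A : Matrix (Fin m) (Fin N) ℝ}
    (h : ∀ x ∈ ρ⁻¹ • l1Ball N ∩ Metric.sphere 0 1, c * m ≤ ∑ i, |matrixOperator A x i|) :
    RobustWidthProperty p ρ (c * (m : ℝ) ^ (p⁻¹).toReal) l1Norm (matrixOperator A) := by
  intro x hx
  by_contra! hlt
  have hx0 : 0 < ‖x‖ := by
    refine norm_pos_iff.2 ?_
    rintro rfl
    simp [l1Norm] at hlt
  have hm' : (0 : ℝ) < m := Nat.cast_pos.2 hm
  have hy : ‖x‖⁻¹ • x ∈ ρ⁻¹ • l1Ball N ∩ Metric.sphere 0 1 := by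
    refine ⟨(mem_smul_l1Ball_iff hρ).2 ?_, ?_⟩
    · rw [l1Norm_smul, abs_of_pos (inv_pos.2 hx0), mul_left_comm, inv_mul_le_iff₀ hx0, mul_one]
      exact hlt.le
    · rw [mem_sphere_zero_iff_norm, norm_smul, norm_inv, norm_norm, inv_mul_cancel₀ hx0.ne']
  have h1 := rpow_mul_sum_abs_le_mul_lpNormVec hp (matrixOperator A (‖x‖⁻¹ • x))
  rw [map_smul, lpNormVec_smul hp, abs_of_pos (inv_pos.2 hx0), ← map_smul] at h1
  have h2 : (m : ℝ) ^ (p⁻¹).toReal * (c * m) ≤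
      m * (‖x‖⁻¹ * lpNormVec p (matrixOperator A x)) :=
    (mul_le_mul_of_nonneg_left (h _ hy) (by positivity)).trans h1
  have h3 : m * (‖x‖⁻¹ * lpNormVec p (matrixOperator A x)) <
      m * (‖x‖⁻¹ * (c * (m : ℝ) ^ (p⁻¹).toReal * ‖x‖)) := by gcongr
  have h4 : m * (‖x‖⁻¹ * (c * (m : ℝ) ^ (p⁻¹).toReal * ‖x‖)) =
      (m : ℝ) ^ (p⁻¹).toReal * (c * m) := by field_simp
  linarith

/-- The rows of a standard Gaussian matrix are independent standard Gaussian vectors. -/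
lemma IsStandardGaussianMatrix.hasLaw_rows {Ω : Type*} [MeasurableSpace Ω] {P : Measure Ω}
    {m N : ℕ} {Φ : Ω → Matrix (Fin m) (Fin N) ℝ} (h : IsStandardGaussianMatrix P Φ) :
    HasLaw (fun ω (i : Fin m) => WithLp.toLp 2 (Φ ω i))
      (Measure.pi fun _ => stdGaussian (EuclideanSpace ℝ (Fin N))) P := by
  have hlaw := h.indep.hasLaw_infinitePi (fun ij : Fin m × Fin N => h.hasLaw ij.1 ij.2)
    (aemeasurable_pi_lambda _ fun ij : Fin m × Fin N => (h.hasLaw ij.1 ij.2).aemeasurable)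
  have hcurry := Measure.infinitePi_map_curry (fun (_ : Fin m) (_ : Fin N) => gaussianReal 0 1)
  have hpi := Measure.pi_map_pi (μ := fun _ : Fin m => Measure.pi fun _ : Fin N => gaussianReal 0 1)
    (f := fun _ => WithLp.toLp 2) (fun _ => (WithLp.measurable_toLp 2 _).aemeasurable)
  simp only [map_pi_eq_stdGaussian] at hpi
  simp only [Measure.infinitePi_eq_pi] at hcurry hlaw
  have hrows : HasLaw (fun v : Fin m → Fin N → ℝ => fun i => WithLp.toLp 2 (v i))
    (Measure.pi fun _ => stdGaussian (EuclideanSpace ℝ (Fin N)))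
    (Measure.pi fun _ => Measure.pi fun _ => gaussianReal 0 1) :=
    ⟨(measurable_pi_lambda _ fun i =>
      (WithLp.measurable_toLp 2 _).comp (measurable_pi_apply i)).aemeasurable, hpi⟩
  exact hrows.comp ((HasLaw.mk (by fun_prop) hcurry).comp hlaw)

theorem theorem4 :
    ∃ c₀ c₁ c₂ : ℝ, 0 < c₀ ∧ 0 < c₁ ∧ 0 < c₂ ∧
      ∀ (m N : ℕ) (ρ : ℝ) (p : ℝ≥0∞), 0 < ρ → 1 ≤ p →
        c₀ * gaussianWidth (ρ⁻¹ • l1Ball N ∩ Metric.sphere 0 1) ^ 2 ≤ (m : ℝ) →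
        ∀ (Ω : Type*) [MeasurableSpace Ω] (P : Measure Ω) [IsProbabilityMeasure P]
          (Φ : Ω → Matrix (Fin m) (Fin N) ℝ), IsStandardGaussianMatrix P Φ →
          1 - 2 * Real.exp (-c₂ * m) <
            P.real {ω | RobustWidthProperty p ρ (c₁ * (m : ℝ) ^ (p⁻¹).toReal) l1Norm
              (matrixOperator (Φ ω))} := by
  have hc := clipMean_pos
  refine ⟨64 / clipMean ^ 2, clipMean / 4, clipMean ^ 2 / 2, by positivity, by positivity,
    by positivity, fun m N ρ p hρ hp hw Ω _ P _ Φ hΦ => ?_⟩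
  set K := ρ⁻¹ • l1Ball N ∩ Metric.sphere 0 1 with hKdef
  set G := {ω | RobustWidthProperty p ρ (clipMean / 4 * (m : ℝ) ^ (p⁻¹).toReal) l1Norm
    (matrixOperator (Φ ω))}
  -- For `m = 0` the asserted lower bound is `-1`.
  rcases m.eq_zero_or_pos with rfl | hm
  · have : 0 ≤ P.real G := measureReal_nonneg
    simp
    linarith
  -- `G` is not known to be measurable: subadditivity replaces the formula for the complement.
  suffices h : P.real Gᶜ ≤ Real.exp (-(clipMean ^ 2 / 2) * m) by
    have h1 : 1 ≤ P.real G + P.real Gᶜ := by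
      simpa using measureReal_union_le (μ := P) G Gᶜ
    linarith [Real.exp_pos (-(clipMean ^ 2 / 2) * m)]
  have hgood {ω : Ω} (h : ∀ x ∈ K, clipMean / 4 * m ≤ ∑ i, |matrixOperator (Φ ω) x i|) :
      ω ∈ G := robustWidthProperty_of_forall_le hm hρ hp h
  rcases K.eq_empty_or_nonempty with hK0 | hne
  · have : G = Set.univ := Set.eq_univ_of_forall fun ω => hgood (by simp [hK0])
    simp [this, Real.exp_nonneg]
  have hK := isCompact_smul_l1Ball_inter_sphere N ρ
  rw [gaussianWidth_eq_integral_stdGaussian hK] at hw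
  refine le_trans ?_ (measureReal_exists_sum_clip_lt_le hK hne Set.inter_subset_right hw)
  set B := {v : Fin m → EuclideanSpace ℝ (Fin N) |
    ∃ x ∈ K, ∑ i, clip (inner ℝ (v i) x) < clipMean / 4 * m}
  have hB : MeasurableSet B := by
    have : B = ⋃ x ∈ K, {v | ∑ i, clip (inner ℝ (v i) x) < clipMean / 4 * m} := by
      ext v; simp [B]
    rw [this]
    exact (isOpen_biUnion fun x _ => isOpen_lt (by fun_prop) continuous_const).measurableSet
  rw [← hΦ.hasLaw_rows.map_eq, map_measureReal_apply_of_aemeasurable hΦ.hasLaw_rows.aemeasurable hB]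
  refine measureReal_mono fun ω hω => ?_
  by_contra hωB
  refine hω (hgood fun x hx => ?_)
  have h1 : clipMean / 4 * m ≤ ∑ i, clip (inner ℝ (WithLp.toLp 2 (Φ ω i)) x) := by
    by_contra! hlt
    exact hωB ⟨x, hx, hlt⟩
  refine h1.trans (Finset.sum_le_sum fun i _ => ?_)
  rw [matrixOperator_apply]
  exact clip_le_abs _
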